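/- For $n\in\mathbb N=\{0,1,2,\dots\}$ let $T_n$ be the coefficient of $x^n$ in the expansion of $(1+x+x^2)^n$ (the $n$th central trinomial coefficient) and let $H_n=\sum_{0<j\le n}1/j$ be the $n$th harmonic number (so $H_0=0$). Let $p>3$ be a prime, and let $\left(\frac{p}{3}\right)$ denote the Legendre symbol. Then $$\sum_{k=0}^{p-1}\frac{T_kH_k}{3^k}\equiv\frac{3+\left(\frac{p}{3}\right)}{2}-p\left(1+\left(\frac{p}{3}\right)\right)\pmod{p^2},$$ where the congruence is between rational numbers whose denominators are not divisible by $p$: the difference of the two sides is $p^2$ times a rational number whose denominator (in lowest terms) is not divisible by $p$. -/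

import Mathlib

/-- The central trinomial coefficient `T_n`: the coefficient of `x ^ n` in `(1 + x + x ^ 2) ^ n`. -/
noncomputable def centralTrinomial (n : ℕ) : ℤ :=
  ((1 + Polynomial.X + Polynomial.X ^ 2 : Polynomial ℤ) ^ n).coeff n

/-- A rational number is `p`-integral if `p` does not divide its reduced denominator. -/
def PIntegral (p : ℕ) (r : ℚ) : Prop := ¬ p ∣ r.den

/-- `a ≡ b (mod p ^ m)` for rational numbers: the congruence in the ring of `p`-integral rationals,
that is, `a` and `b` are `p`-integral and differ by `p ^ m` times a `p`-integral rational. -/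
def RatModEq (p m : ℕ) (a b : ℚ) : Prop :=
  PIntegral p a ∧ PIntegral p b ∧ ∃ r : ℚ, PIntegral p r ∧ a - b = (p : ℚ) ^ m * r

/-! Write t_n = T_n/3^n. Since 1+x+x^2 = (x-1)^2+3x, t_n = ∑ C(n,k) c_k with c_k = (-1/3)^k C(2k,k).
Summing C(n,k) H_n over n gives the exact identity
`sum_range_succ_centralTrinomial_mul_harmonic_eq`: up to n = N the sum is 3/2 + t_N/2 -
(N+1)(3t_{N+1} + t_N) + (N+1) H_N Q. At N = p-1, Q is p-integral and p ∣ H_{p-1}, so the last term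
vanishes mod p^2. It remains that t_{p-1} ≡ (p/3) mod p^2 and, because of the factor p, only that
3t_p ≡ 1 mod p. -/

open Polynomial in
theorem centralTrinomial_eq_sum (n : ℕ) :
    centralTrinomial n =
      ∑ k ∈ Finset.range (n + 1), (-1) ^ k * 3 ^ (n - k) * (Nat.centralBinom k : ℤ) * n.choose k := by
  have h : (1 + X + X ^ 2 : ℤ[X]) = (X + C (-1)) ^ 2 + C 3 * X := by
    simp only [map_neg, map_one, map_ofNat]; ring
  rw [centralTrinomial, h, add_pow, finsetSum_coeff]
  refine Finset.sum_congr rfl fun k hk => ?_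
  have hk' : k ≤ n := Nat.lt_succ_iff.mp (Finset.mem_range.mp hk)
  have e : ((X + C (-1)) ^ 2) ^ k * (C 3 * X) ^ (n - k) * (n.choose k : ℤ[X]) =
      C (3 ^ (n - k) * (n.choose k : ℤ)) * ((X + C (-1)) ^ (2 * k) * X ^ (n - k)) := by
    rw [mul_pow, ← pow_mul, C_mul, C_pow, ← C_eq_natCast]; ring
  rw [e, coeff_C_mul, coeff_mul_X_pow', if_pos (Nat.sub_le _ _), Nat.sub_sub_self hk',
    coeff_X_add_C_pow, Nat.centralBinom, two_mul, Nat.add_sub_cancel]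
  ring

-- Factor 1+x+x^2 = (x-w)(x-w^2) and compare coefficients.
open Polynomial in
theorem centralTrinomial_eq_sum_sq {A : Type*} [CommRing A] {w : A} (hw : 1 + w + w ^ 2 = 0)
    (n : ℕ) :
    (centralTrinomial n : A) =
      ∑ k ∈ Finset.range (n + 1), (-1) ^ n * w ^ (n + k) * (n.choose k : A) ^ 2 := by
  have h : (1 + X + X ^ 2 : ℤ[X]).map (Int.castRingHom A) =
      (X + C (-w)) * (X + C (-w ^ 2)) := by
    have h3 : w * w ^ 2 = 1 := by linear_combination (w - 1) * hw
    have e1 : (X + C (-w)) * (X + C (-w ^ 2)) = X ^ 2 + C (-w - w ^ 2) * X + C (w * w ^ 2) := by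
      simp only [map_neg, map_sub, map_mul]; ring
    have e2 : -w - w ^ 2 = 1 := by linear_combination -hw
    rw [e1, h3, e2]
    simp; ring
  have hc : (centralTrinomial n : A) = (((X + C (-w)) * (X + C (-w ^ 2))) ^ n).coeff n := by
    rw [← h, ← Polynomial.map_pow, coeff_map, centralTrinomial]; rfl
  rw [hc, mul_pow, coeff_mul, Finset.Nat.sum_antidiagonal_eq_sum_range_succ_mk]
  refine Finset.sum_congr rfl fun k hk => ?_
  have hk' : k ≤ n := Nat.lt_succ_iff.mp (Finset.mem_range.mp hk)
  obtain ⟨j, rfl⟩ := Nat.exists_eq_add_of_le hk'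
  have hc' := Nat.choose_symm hk'
  rw [Nat.add_sub_cancel_left] at hc'
  simp only [coeff_X_add_C_pow, Nat.add_sub_cancel_left, Nat.add_sub_cancel, hc']
  rw [neg_pow w, neg_pow (w ^ 2)]
  ring

/-! ### T_{p-1} modulo p^2 -/

theorem dvd_choose_prime_sub_one_sub {p : ℕ} (hp : p.Prime) {k : ℕ} (hk : k < p) :
    ((p : ℤ)) ∣ (p - 1).choose k - (-1) ^ k := by
  induction k with
  | zero => simp
  | succ k ih =>
    have h1 : (p : ℤ) ∣ p.choose (k + 1) := by
      exact_mod_cast hp.dvd_choose_self (Nat.succ_ne_zero k) hk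
    have h2 : p.choose (k + 1) = (p - 1).choose k + (p - 1).choose (k + 1) := by
      conv_lhs => rw [← Nat.sub_add_cancel hp.one_le]
      rw [Nat.choose_succ_succ]
    rw [h2] at h1
    obtain ⟨a, ha⟩ := dvd_sub h1 (ih (by omega))
    push_cast at ha
    exact ⟨a, by linear_combination ha⟩

/-- As C(p-1,k) - (-1)^k is a multiple of p, its square is 0. This linearizes the squares in
`centralTrinomial_eq_sum_sq`, leaving a binomial and a geometric sum. -/
theorem choose_prime_sub_one_sq {p : ℕ} (hp : p.Prime) {A : Type*} [CommRing A]
    (hA : (p : A) ^ 2 = 0) {k : ℕ} (hk : k < p) :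
    ((p - 1).choose k : A) ^ 2 = 2 * (-1) ^ k * (p - 1).choose k - 1 := by
  obtain ⟨c, hc⟩ := dvd_choose_prime_sub_one_sub hp hk
  have h := congrArg (Int.cast : ℤ → A) hc
  push_cast at h
  have h1 : ((-1 : A) ^ k) ^ 2 = 1 := by rw [← pow_mul, mul_comm, pow_mul]; simp
  linear_combination (((p - 1).choose k : A) - (-1) ^ k + p * c) * h + (c : A) ^ 2 * hA - h1

theorem centralTrinomial_prime_sub_one_of_root {p : ℕ} (hp : p.Prime) (hp2 : Odd p) {A : Type*}
    [CommRing A] (hA : (p : A) ^ 2 = 0) {w : A} (hw : 1 + w + w ^ 2 = 0) :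
    (centralTrinomial (p - 1) : A) =
      2 * w ^ (p - 1) * (-3 * w) ^ (p / 2) - w ^ (p - 1) * ∑ k ∈ Finset.range p, w ^ k := by
  have hs : (-1 : A) ^ (p - 1) = 1 := (Nat.Odd.sub_odd hp2 odd_one).neg_one_pow
  rw [centralTrinomial_eq_sum_sq hw, Nat.sub_add_cancel hp.one_le]
  have h1 : (-3 * w) ^ (p / 2) = ∑ k ∈ Finset.range p, (-w) ^ k * ((p - 1).choose k : A) := by
    -- The half power of -3w is thus (1-w)^(p-1), a binomial sum.
    have h2 : -3 * w = (-w + 1) ^ 2 := by linear_combination -hw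
    rw [h2, ← pow_mul]
    have h3 : 2 * (p / 2) = p - 1 := by obtain ⟨m, rfl⟩ := hp2; omega
    rw [h3, add_pow, Nat.sub_add_cancel hp.one_le]
    simp
  rw [h1, Finset.mul_sum, Finset.mul_sum, ← Finset.sum_sub_distrib]
  refine Finset.sum_congr rfl fun k hk => ?_
  rw [choose_prime_sub_one_sq hp hA (Finset.mem_range.mp hk), hs, neg_pow w, pow_add]
  ring

theorem sum_range_pow_of_root {A : Type*} [CommRing A] {w : A} (hw : 1 + w + w ^ 2 = 0) (m : ℕ) :
    ∑ k ∈ Finset.range (3 * m), w ^ k = 0 := by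
  induction m with
  | zero => simp
  | succ m ih =>
    rw [Nat.mul_succ, Finset.sum_range_succ, Finset.sum_range_succ, Finset.sum_range_succ, ih]
    linear_combination w ^ (3 * m) * hw

theorem legendreSym_three_of_mod_one {p : ℕ} (h : p % 3 = 1) : legendreSym 3 (p : ℤ) = 1 := by
  rw [legendreSym.mod]
  have : (p : ℤ) % (3 : ℕ) = 1 := by omega
  rw [this]; simp

theorem legendreSym_three_of_mod_two {p : ℕ} (h : p % 3 = 2) : legendreSym 3 (p : ℤ) = -1 := by
  rw [legendreSym.mod]
  have : (p : ℤ) % (3 : ℕ) = 2 := by omega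
  rw [this]; decide

theorem prime_mod_six {p : ℕ} (hp : p.Prime) (hp3 : 3 < p) : p % 6 = 1 ∨ p % 6 = 5 := by
  have h2 : ¬ 2 ∣ p := fun h => by have := (Nat.prime_dvd_prime_iff_eq Nat.prime_two hp).1 h; omega
  have h3 : ¬ 3 ∣ p := fun h => by
    have := (Nat.prime_dvd_prime_iff_eq Nat.prime_three hp).1 h; omega
  omega

theorem centralTrinomial_prime_sub_one_eq_legendreSym_of_root {p : ℕ} (hp : p.Prime) (hp3 : 3 < p) {A : Type*}
    [CommRing A] (hA : (p : A) ^ 2 = 0) {w : A} (hw : 1 + w + w ^ 2 = 0) :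
    (centralTrinomial (p - 1) : A) = 2 * (-3) ^ (p / 2) - (legendreSym 3 (p : ℤ) : A) := by
  have hw3 : w ^ 3 = 1 := by linear_combination (w - 1) * hw
  have hodd : Odd p := hp.odd_of_ne_two (by omega)
  rw [centralTrinomial_prime_sub_one_of_root hp hodd hA hw]
  rcases prime_mod_six hp hp3 with h | h
  · rw [legendreSym_three_of_mod_one (by omega)]
    obtain ⟨m, rfl⟩ : ∃ m, p = 6 * m + 1 := ⟨p / 6, by omega⟩
    have e1 : (6 * m + 1) / 2 = 3 * m := by omega
    have e2 : 6 * m + 1 - 1 = 3 * (2 * m) := by omega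
    have e3 : 6 * m + 1 = 3 * (2 * m) + 1 := by omega
    rw [e1, e2, e3, Finset.sum_range_succ, sum_range_pow_of_root hw, mul_pow, pow_mul w 3,
      pow_mul w 3, hw3]
    simp
  · rw [legendreSym_three_of_mod_two (by omega)]
    obtain ⟨m, rfl⟩ : ∃ m, p = 6 * m + 5 := ⟨p / 6, by omega⟩
    have e1 : (6 * m + 5) / 2 = 3 * m + 2 := by omega
    have e2 : 6 * m + 5 - 1 = 3 * (2 * m + 1) + 1 := by omega
    have e3 : 6 * m + 5 = 3 * (2 * m + 1) + 1 + 1 := by omega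
    rw [e1, e2, e3, Finset.sum_range_succ, Finset.sum_range_succ, sum_range_pow_of_root hw, mul_pow,
      pow_succ w (3 * _), pow_add w (3 * m), pow_mul w 3, pow_mul w 3, hw3]
    push_cast
    simp only [one_pow]
    linear_combination 2 * (-3) ^ (3 * m + 2) * hw3 - hw

/-- Euler's criterion for -3, with (-3/p) = (p/3) by quadratic reciprocity. -/
theorem dvd_neg_three_pow_half_sub_legendreSym {p : ℕ} (hp : p.Prime) (hp3 : 3 < p) :
    (p : ℤ) ∣ (-3) ^ (p / 2) - legendreSym 3 (p : ℤ) := by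
  have : Fact p.Prime := ⟨hp⟩
  have h3 : p ≠ 3 := by omega
  have h2 : p ≠ 2 := by omega
  rw [← ZMod.intCast_zmod_eq_zero_iff_dvd]
  have h := legendreSym.eq_pow p (-3)
  have h' : legendreSym 3 (p : ℤ) = legendreSym p (-3) := by
    have e := legendreSym.mul p (-1) 3
    have q := legendreSym.quadratic_reciprocity' (p := p) (q := 3) h2 (by norm_num)
    rw [legendreSym.at_neg_one h2, ZMod.χ₄_eq_neg_one_pow (hp.eq_two_or_odd.resolve_left h2)] at e
    simp only [Nat.reduceDiv, mul_one] at q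
    rw [q]
    simpa using e.symm
  rw [h']
  push_cast
  rw [h]
  push_cast
  ring

/-- Adjoins a primitive cube root of unity to ℤ/p^2; the extension is injective, so identities
descend. -/
theorem exists_root_quadraticAlgebra (R : Type*) [CommRing R] :
    ∃ w : QuadraticAlgebra R (-1) (-1), 1 + w + w ^ 2 = 0 := by
  refine ⟨⟨0, 1⟩, ?_⟩
  ext <;> simp [pow_two, QuadraticAlgebra.re_one, QuadraticAlgebra.im_one]

theorem centralTrinomial_prime_sub_one_cast {p : ℕ} (hp : p.Prime) (hp3 : 3 < p) {R : Type*}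
    [CommRing R] (hR : (p : R) ^ 2 = 0) :
    (centralTrinomial (p - 1) : R) = 2 * (-3) ^ (p / 2) - (legendreSym 3 (p : ℤ) : R) := by
  obtain ⟨w, hw⟩ := exists_root_quadraticAlgebra R
  have hA : ((p : ℕ) : QuadraticAlgebra R (-1) (-1)) ^ 2 = 0 := by
    simpa using congrArg (algebraMap R (QuadraticAlgebra R (-1) (-1))) hR
  have h := centralTrinomial_prime_sub_one_eq_legendreSym_of_root hp hp3 hA hw
  have hinj : Function.Injective (algebraMap R (QuadraticAlgebra R (-1) (-1))) :=
    QuadraticAlgebra.C_injective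
  have hz : ((centralTrinomial (p - 1) : ℤ) : R) =
      ((2 * (-3) ^ (p / 2) - legendreSym 3 (p : ℤ) : ℤ) : R) := by
    refine hinj ?_
    rw [map_intCast, map_intCast, h]
    push_cast
    rfl
  simpa using hz

theorem centralTrinomial_prime_sub_one {p : ℕ} (hp : p.Prime) (hp3 : 3 < p) :
    (p : ℤ) ^ 2 ∣ centralTrinomial (p - 1) - legendreSym 3 (p : ℤ) * 3 ^ (p - 1) := by
  have key : (p : ℤ) ^ 2 ∣
      centralTrinomial (p - 1) - (2 * (-3) ^ (p / 2) - legendreSym 3 (p : ℤ)) := by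
    have hR : (p : ZMod (p ^ 2)) ^ 2 = 0 := by exact_mod_cast ZMod.natCast_self (p ^ 2)
    rw [← Nat.cast_pow, ← ZMod.intCast_zmod_eq_zero_iff_dvd]
    push_cast
    rw [centralTrinomial_prime_sub_one_cast hp hp3 hR, sub_self]
  have he : legendreSym 3 (p : ℤ) ^ 2 = 1 := by
    rcases prime_mod_six hp hp3 with h | h
    · rw [legendreSym_three_of_mod_one (by omega)]; rfl
    · rw [legendreSym_three_of_mod_two (by omega)]; rfl
  have hpow : (3 : ℤ) ^ (p - 1) = ((-3) ^ (p / 2)) ^ 2 := by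
    have hodd : Odd p := hp.odd_of_ne_two (by omega)
    have h3 : p / 2 * 2 = p - 1 := by obtain ⟨m, rfl⟩ := hodd; omega
    rw [← pow_mul, h3, (Nat.Odd.sub_odd hodd odd_one).neg_pow]
  obtain ⟨c, hc⟩ := key
  obtain ⟨d, hd⟩ := dvd_neg_three_pow_half_sub_legendreSym hp hp3
  refine ⟨c - legendreSym 3 (p : ℤ) * d ^ 2, ?_⟩
  rw [hpow]
  generalize (-3 : ℤ) ^ (p / 2) = h at *
  generalize legendreSym 3 (p : ℤ) = e at *
  -- With e = ±1 and h ≡ e mod p, (h-e)^2 ≡ 0 mod p^2 gives 2h - e ≡ e h^2 = e 3^(p-1).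
  linear_combination hc - e * (h - e + p * d) * hd + (e - 2 * h) * he

open Polynomial in
theorem centralTrinomial_prime {p : ℕ} (hp : p.Prime) : (p : ℤ) ∣ centralTrinomial p - 1 := by
  have : Fact p.Prime := ⟨hp⟩
  rw [← ZMod.intCast_zmod_eq_zero_iff_dvd]
  have h : (centralTrinomial p : ZMod p) = ((1 + X + X ^ 2 : (ZMod p)[X]) ^ p).coeff p := by
    have : (1 + X + X ^ 2 : (ZMod p)[X]) = (1 + X + X ^ 2 : ℤ[X]).map (Int.castRingHom _) := by
      simp
    rw [this, ← Polynomial.map_pow, coeff_map, centralTrinomial]; rfl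
  push_cast
  rw [h, add_pow_char, add_pow_char, one_pow, ← pow_mul, coeff_add, coeff_add, coeff_X_pow,
    coeff_X_pow, coeff_one]
  have := hp.pos
  simp [hp.ne_zero]

/-- The ring of `p`-integral rational numbers. -/
def pIntegralSubring (p : ℕ) (hp : p.Prime) : Subring ℚ where
  carrier := {r | PIntegral p r}
  zero_mem' := by simpa [PIntegral] using hp.ne_one
  one_mem' := by simpa [PIntegral] using hp.ne_one
  add_mem' {a b} ha hb h := (hp.dvd_mul.1 (h.trans (Rat.add_den_dvd a b))).elim ha hb
  mul_mem' {a b} ha hb h := (hp.dvd_mul.1 (h.trans (Rat.mul_den_dvd a b))).elim ha hb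
  neg_mem' {a} ha := by simpa [PIntegral] using ha

theorem mem_pIntegralSubring {p : ℕ} (hp : p.Prime) {r : ℚ} :
    r ∈ pIntegralSubring p hp ↔ PIntegral p r := Iff.rfl

theorem inv_natCast_mem_pIntegralSubring {p : ℕ} (hp : p.Prime) {a : ℕ} (ha : ¬ p ∣ a) :
    (a : ℚ)⁻¹ ∈ pIntegralSubring p hp := by
  rw [mem_pIntegralSubring, PIntegral, Rat.inv_natCast_den]
  split_ifs with h
  · simp [h] at ha
  · exact ha

/-- Pair 1/i with 1/(p-i): their sum is p/(i(p-i)). -/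
theorem exists_harmonic_prime_sub_one {p : ℕ} (hp : p.Prime) (hp3 : 3 < p) :
    ∃ r ∈ pIntegralSubring p hp, harmonic (p - 1) = p * r := by
  have h2 : ((2 : ℕ) : ℚ)⁻¹ ∈ pIntegralSubring p hp :=
    inv_natCast_mem_pIntegralSubring hp (Nat.not_dvd_of_pos_of_lt (by norm_num) (by omega))
  have hinv : ∀ i, 0 < i → i < p → (i : ℚ)⁻¹ ∈ pIntegralSubring p hp := fun i h0 h1 =>
    inv_natCast_mem_pIntegralSubring hp (Nat.not_dvd_of_pos_of_lt h0 h1)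
  refine ⟨((2 : ℕ) : ℚ)⁻¹ * ∑ i ∈ Finset.range (p - 1), ((i + 1 : ℕ) : ℚ)⁻¹ *
    ((p - 1 - 1 - i + 1 : ℕ) : ℚ)⁻¹, ?_, ?_⟩
  · refine mul_mem h2 (sum_mem fun i hi => ?_)
    rw [Finset.mem_range] at hi
    exact mul_mem (hinv _ (by omega) (by omega)) (hinv _ (by omega) (by omega))
  · have hr := Finset.sum_range_reflect (fun i => ((i + 1 : ℕ) : ℚ)⁻¹) (p - 1)
    have e : (2 : ℚ) * harmonic (p - 1) = p * ∑ i ∈ Finset.range (p - 1), ((i + 1 : ℕ) : ℚ)⁻¹ *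
        ((p - 1 - 1 - i + 1 : ℕ) : ℚ)⁻¹ := by
      rw [two_mul, harmonic]
      nth_rewrite 1 [← hr]
      rw [← Finset.sum_add_distrib, Finset.mul_sum]
      refine Finset.sum_congr rfl fun i hi => ?_
      rw [Finset.mem_range] at hi
      obtain ⟨j, rfl⟩ : ∃ j, p = i + 1 + (j + 1) := ⟨p - i - 2, by omega⟩
      have : i + 1 + (j + 1) - 1 - 1 - i = j := by omega
      rw [this]
      have h1 : ((i + 1 : ℕ) : ℚ) ≠ 0 := by positivity
      have h2 : ((j + 1 : ℕ) : ℚ) ≠ 0 := by positivity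
      field_simp
      push_cast; ring
    push_cast
    push_cast at e
    linear_combination e / 2

/-! ### Exact evaluation of the harmonic sum -/

theorem sum_range_choose_mul_harmonic (N k : ℕ) :
    ∑ n ∈ Finset.range N, (n.choose k : ℚ) * harmonic n =
      N.choose (k + 1) * (harmonic N - ((k : ℚ) + 1)⁻¹) := by
  induction N with
  | zero => simp
  | succ N ih =>
    rw [Finset.sum_range_succ, ih, harmonic_succ, Nat.choose_succ_succ]
    have h : ((N : ℚ) + 1) * N.choose k = (N.choose k + N.choose (k + 1)) * (k + 1) := by
      have := Nat.add_one_mul_choose_eq N k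
      rw [Nat.choose_succ_succ] at this
      exact_mod_cast this
    have h1 : (N : ℚ) + 1 ≠ 0 := by positivity
    have h2 : (k : ℚ) + 1 ≠ 0 := by positivity
    push_cast
    field_simp
    linear_combination h

/-- The coefficients of `T_n / 3 ^ n` in the binomial basis. -/
def trinomialCoeff (k : ℕ) : ℚ := (-1 / 3) ^ k * Nat.centralBinom k

theorem centralTrinomial_div_eq_sum {n M : ℕ} (h : n < M) :
    (centralTrinomial n : ℚ) / 3 ^ n =
      ∑ k ∈ Finset.range M, (n.choose k : ℚ) * trinomialCoeff k := by
  have h1 : ∑ k ∈ Finset.range M, (n.choose k : ℚ) * trinomialCoeff k =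
      ∑ k ∈ Finset.range (n + 1), (n.choose k : ℚ) * trinomialCoeff k := by
    symm
    refine Finset.sum_subset (Finset.range_mono h) fun k _ hk => ?_
    rw [Finset.mem_range, not_lt] at hk
    rw [Nat.choose_eq_zero_of_lt hk]; simp
  rw [h1, centralTrinomial_eq_sum]
  push_cast
  rw [Finset.sum_div]
  refine Finset.sum_congr rfl fun k hk => ?_
  obtain ⟨j, rfl⟩ := Nat.exists_eq_add_of_le (Nat.lt_succ_iff.mp (Finset.mem_range.mp hk))
  rw [trinomialCoeff, Nat.add_sub_cancel_left, div_pow, pow_add]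
  field_simp

theorem trinomialCoeff_eq (k : ℕ) :
    trinomialCoeff k = (k + 1) * ((-1 / 3) ^ k * catalan k) := by
  rw [trinomialCoeff, ← succ_mul_catalan_eq_centralBinom]
  push_cast; ring

theorem trinomialCoeff_succ (k : ℕ) :
    trinomialCoeff (k + 1) = -(2 / 3) * (2 * k + 1) * ((-1 / 3) ^ k * catalan k) := by
  have h := Nat.succ_mul_centralBinom_succ k
  rw [← succ_mul_catalan_eq_centralBinom k] at h
  have h2 : (Nat.centralBinom (k + 1) : ℚ) = 2 * (2 * k + 1) * catalan k := by
    have h3 : ((k + 1 : ℕ) : ℚ) * Nat.centralBinom (k + 1) =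
        2 * (2 * k + 1) * ((k + 1 : ℕ) * catalan k) := by exact_mod_cast h
    have h4 : ((k + 1 : ℕ) : ℚ) ≠ 0 := by positivity
    exact mul_left_cancel₀ h4 (by linear_combination h3)
  rw [trinomialCoeff, h2]; ring

theorem sum_range_centralTrinomial_mul_harmonic (N : ℕ) :
    ∑ n ∈ Finset.range N, (centralTrinomial n : ℚ) * harmonic n / 3 ^ n =
      ∑ k ∈ Finset.range N,
        trinomialCoeff k * (N.choose (k + 1) * (harmonic N - ((k : ℚ) + 1)⁻¹)) := by
  simp_rw [← sum_range_choose_mul_harmonic, Finset.mul_sum]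
  rw [Finset.sum_comm]
  refine Finset.sum_congr rfl fun n hn => ?_
  rw [mul_div_right_comm, centralTrinomial_div_eq_sum (Finset.mem_range.mp hn), Finset.sum_mul]
  exact Finset.sum_congr rfl fun k _ => by ring

/-- Writing c_k = (k+1) d_k turns (k+1) C(N+1,k+1) into (N+1) C(N,k), which cancels the denominators
and isolates H_N. -/
theorem sum_range_succ_centralTrinomial_mul_harmonic (N : ℕ) :
    ∑ n ∈ Finset.range (N + 1), (centralTrinomial n : ℚ) * harmonic n / 3 ^ n =
      -∑ k ∈ Finset.range (N + 1), (N.choose (k + 1) : ℚ) * ((-1 / 3) ^ k * catalan k) +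
      (N + 1) * harmonic N *
        ∑ k ∈ Finset.range (N + 1), (N.choose k : ℚ) * ((-1 / 3) ^ k * catalan k) := by
  rw [sum_range_centralTrinomial_mul_harmonic, Finset.mul_sum, ← Finset.sum_neg_distrib,
    ← Finset.sum_add_distrib]
  refine Finset.sum_congr rfl fun k _ => ?_
  have h : ((N : ℚ) + 1) * N.choose k = (N.choose k + N.choose (k + 1)) * (k + 1) := by
    have := Nat.add_one_mul_choose_eq N k
    rw [Nat.choose_succ_succ] at this
    exact_mod_cast this
  have h1 : (N : ℚ) + 1 ≠ 0 := by positivity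
  have h2 : (k : ℚ) + 1 ≠ 0 := by positivity
  rw [trinomialCoeff_eq, harmonic_succ, Nat.choose_succ_succ]
  push_cast
  generalize (-1 / 3 : ℚ) ^ k * catalan k = c
  field_simp
  linear_combination -c * (1 + harmonic N * (N + 1)) * h

/-- Termwise, d_k = 2c_k + (3/2)c_{k+1}; the c_{k+1} part is t_N without its k = 0 term. -/
theorem sum_choose_succ_mul_catalan (N : ℕ) :
    ∑ k ∈ Finset.range (N + 1), (N.choose (k + 1) : ℚ) * ((-1 / 3) ^ k * catalan k) =
      3 / 2 * (centralTrinomial N / 3 ^ N - 1) +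
        2 * ∑ k ∈ Finset.range (N + 1), (N.choose (k + 1) : ℚ) * trinomialCoeff k := by
  have h0 : (N.choose 0 : ℚ) * trinomialCoeff 0 = 1 := by simp [trinomialCoeff]
  rw [centralTrinomial_div_eq_sum (show N < N + 1 + 1 by omega), Finset.sum_range_succ' _ (N + 1), h0,
    add_sub_cancel_right, Finset.mul_sum, Finset.mul_sum, ← Finset.sum_add_distrib]
  refine Finset.sum_congr rfl fun k _ => ?_
  rw [trinomialCoeff_succ, trinomialCoeff_eq]
  ring

/-- Rests on 2c_k = (k+1)(4c_k + 3c_{k+1}), the recurrence of central binomials. -/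
theorem sum_choose_succ_mul_trinomialCoeff (N : ℕ) :
    2 * ∑ k ∈ Finset.range (N + 1), ((N + 1).choose (k + 1) : ℚ) * trinomialCoeff k =
      (N + 1) * (3 * (centralTrinomial (N + 1) / 3 ^ (N + 1)) + centralTrinomial N / 3 ^ N) := by
  have hA : ((N : ℚ) + 1) * (centralTrinomial (N + 1) / 3 ^ (N + 1)) =
      ∑ k ∈ Finset.range (N + 1), ((k : ℚ) + 1) * (N + 1).choose (k + 1) * trinomialCoeff k +
      ∑ k ∈ Finset.range (N + 1),
        ((k : ℚ) + 1) * (N + 1).choose (k + 1) * trinomialCoeff (k + 1) := by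
    have e1 : ∑ k ∈ Finset.range (N + 1 + 1),
        ((k : ℚ) + 1) * (N + 1).choose (k + 1) * trinomialCoeff k =
        ∑ k ∈ Finset.range (N + 1), ((k : ℚ) + 1) * (N + 1).choose (k + 1) * trinomialCoeff k := by
      rw [Finset.sum_range_succ, Nat.choose_succ_self]; simp
    have e2 : ∑ k ∈ Finset.range (N + 1 + 1), (k : ℚ) * (N + 1).choose k * trinomialCoeff k =
        ∑ k ∈ Finset.range (N + 1),
          ((k : ℚ) + 1) * (N + 1).choose (k + 1) * trinomialCoeff (k + 1) := by
      rw [Finset.sum_range_succ']; simp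
    rw [← e1, ← e2, centralTrinomial_div_eq_sum (Nat.lt_succ_self (N + 1)), Finset.mul_sum,
      ← Finset.sum_add_distrib]
    refine Finset.sum_congr rfl fun k hk => ?_
    have hk' : k ≤ N + 1 := Nat.lt_succ_iff.mp (Finset.mem_range.mp hk)
    have h := congrArg (Nat.cast : ℕ → ℚ) (Nat.choose_succ_right_eq (N + 1) k)
    push_cast [hk'] at h
    linear_combination -trinomialCoeff k * h
  have hB : ((N : ℚ) + 1) * (centralTrinomial N / 3 ^ N) =
      ∑ k ∈ Finset.range (N + 1), ((k : ℚ) + 1) * (N + 1).choose (k + 1) * trinomialCoeff k := by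
    rw [centralTrinomial_div_eq_sum (Nat.lt_succ_self N), Finset.mul_sum]
    refine Finset.sum_congr rfl fun k _ => ?_
    have h := congrArg (Nat.cast : ℕ → ℚ) (Nat.add_one_mul_choose_eq N k)
    push_cast at h
    linear_combination trinomialCoeff k * h
  rw [mul_add, mul_left_comm, hA, hB, mul_add, Finset.mul_sum, Finset.mul_sum, Finset.mul_sum,
    ← Finset.sum_add_distrib, ← Finset.sum_add_distrib]
  refine Finset.sum_congr rfl fun k _ => ?_
  rw [trinomialCoeff_succ, trinomialCoeff_eq]
  ring

theorem sum_range_succ_centralTrinomial_mul_harmonic_eq (N : ℕ) :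
    ∑ n ∈ Finset.range (N + 1), (centralTrinomial n : ℚ) * harmonic n / 3 ^ n =
      3 / 2 + centralTrinomial N / 3 ^ N / 2 -
        (N + 1) * (3 * (centralTrinomial (N + 1) / 3 ^ (N + 1)) + centralTrinomial N / 3 ^ N) +
      (N + 1) * harmonic N *
        ∑ k ∈ Finset.range (N + 1), (N.choose k : ℚ) * ((-1 / 3) ^ k * catalan k) := by
  have h : ∑ k ∈ Finset.range (N + 1), ((N + 1).choose (k + 1) : ℚ) * trinomialCoeff k =
      centralTrinomial N / 3 ^ N +
        ∑ k ∈ Finset.range (N + 1), (N.choose (k + 1) : ℚ) * trinomialCoeff k := by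
    rw [centralTrinomial_div_eq_sum (Nat.lt_succ_self N), ← Finset.sum_add_distrib]
    refine Finset.sum_congr rfl fun k _ => ?_
    rw [Nat.choose_succ_succ]; push_cast; ring
  rw [sum_range_succ_centralTrinomial_mul_harmonic, sum_choose_succ_mul_catalan,
    ← sum_choose_succ_mul_trinomialCoeff, h]
  ring

theorem theorem1p2 (p : ℕ) (hp : p.Prime) (hp3 : 3 < p) :
    RatModEq p 2
      (∑ k ∈ Finset.range p, (centralTrinomial k : ℚ) * harmonic k / 3 ^ k)
      ((3 + (legendreSym 3 (p : ℤ) : ℚ)) / 2 - (p : ℚ) * (1 + (legendreSym 3 (p : ℤ) : ℚ))) := by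
  have hinv2 : (2 : ℚ)⁻¹ ∈ pIntegralSubring p hp := by
    exact_mod_cast inv_natCast_mem_pIntegralSubring hp
      (Nat.not_dvd_of_pos_of_lt (show 0 < 2 by norm_num) (by omega))
  have hinv3 : (3 : ℚ)⁻¹ ∈ pIntegralSubring p hp := by
    exact_mod_cast inv_natCast_mem_pIntegralSubring hp
      (Nat.not_dvd_of_pos_of_lt (show 0 < 3 by norm_num) hp3)
  have hnat : ∀ n : ℕ, (n : ℚ) ∈ pIntegralSubring p hp := natCast_mem _
  have hint : ∀ n : ℤ, (n : ℚ) ∈ pIntegralSubring p hp := intCast_mem _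
  obtain ⟨r, hr, hH⟩ := exists_harmonic_prime_sub_one hp hp3
  obtain ⟨a, ha⟩ := centralTrinomial_prime_sub_one hp hp3
  -- Both terms are 1 mod p, by Frobenius and by Fermat.
  obtain ⟨b, hb⟩ : (p : ℤ) ∣ centralTrinomial p - 3 ^ (p - 1) := by
    have h1 := centralTrinomial_prime hp
    have h2 : (p : ℤ) ∣ 3 ^ (p - 1) - 1 := by
      refine (Int.ModEq.pow_card_sub_one_eq_one hp ?_).symm.dvd
      exact_mod_cast ((Nat.coprime_primes Nat.prime_three hp).2 (by omega))
    have := dvd_sub h1 h2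
    rwa [sub_sub_sub_cancel_right] at this
  have hS := sum_range_succ_centralTrinomial_mul_harmonic_eq (p - 1)
  have hp1 : ((p - 1 : ℕ) : ℚ) + 1 = p := by
    exact_mod_cast Nat.sub_add_cancel hp.one_le
  set Q := ∑ k ∈ Finset.range (p - 1 + 1), ((p - 1).choose k : ℚ) * ((-1 / 3) ^ k * catalan k)
    with hQdef
  have hQ : Q ∈ pIntegralSubring p hp := by
    refine sum_mem fun k _ => mul_mem (hnat _) (mul_mem (pow_mem ?_ _) (hnat _))
    rw [div_eq_mul_inv]
    exact mul_mem (neg_mem (one_mem _)) hinv3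
  clear_value Q
  rw [hp1, Nat.sub_add_cancel hp.one_le, hH] at hS
  have ha' : (centralTrinomial (p - 1) : ℚ) / 3 ^ (p - 1) =
      legendreSym 3 (p : ℤ) + p ^ 2 * (a * (3 : ℚ)⁻¹ ^ (p - 1)) := by
    have := congrArg (Int.cast : ℤ → ℚ) ha
    push_cast at this
    rw [inv_pow]
    field_simp
    linear_combination this
  have hb' : 3 * ((centralTrinomial p : ℚ) / 3 ^ p) = 1 + p * (b * (3 : ℚ)⁻¹ ^ (p - 1)) := by
    have := congrArg (Int.cast : ℤ → ℚ) hb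
    push_cast at this
    have h3 : (3 : ℚ) ^ p = 3 ^ (p - 1) * 3 := by rw [← pow_succ, Nat.sub_add_cancel hp.one_le]
    rw [inv_pow, h3]
    field_simp
    linear_combination this
  have ht : ∀ c : ℤ, (c : ℚ) * (3 : ℚ)⁻¹ ^ (p - 1) ∈ pIntegralSubring p hp := fun c =>
    mul_mem (hint c) (pow_mem hinv3 _)
  have hA := ht a
  have hB := ht b
  rw [ha', hb'] at hS
  generalize (a : ℚ) * (3 : ℚ)⁻¹ ^ (p - 1) = A at hS hA
  generalize (b : ℚ) * (3 : ℚ)⁻¹ ^ (p - 1) = B at hS hB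
  have hR : (3 + (legendreSym 3 (p : ℤ) : ℚ)) / 2 - (p : ℚ) * (1 + (legendreSym 3 (p : ℤ) : ℚ)) ∈
      pIntegralSubring p hp := by
    rw [div_eq_mul_inv]
    exact sub_mem (mul_mem (add_mem (by exact_mod_cast hnat 3) (hint _)) hinv2)
      (mul_mem (hnat _) (add_mem (one_mem _) (hint _)))
  have hC : A * (2 : ℚ)⁻¹ - (B + p * A) + r * Q ∈ pIntegralSubring p hp :=
    add_mem (sub_mem (mul_mem hA hinv2) (add_mem hB (mul_mem (hnat _) hA))) (mul_mem hr hQ)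
  have hdiff : ∑ k ∈ Finset.range p, (centralTrinomial k : ℚ) * harmonic k / 3 ^ k -
      ((3 + (legendreSym 3 (p : ℤ) : ℚ)) / 2 - (p : ℚ) * (1 + (legendreSym 3 (p : ℤ) : ℚ))) =
      (p : ℚ) ^ 2 * (A * (2 : ℚ)⁻¹ - (B + p * A) + r * Q) := by
    rw [hS]; ring
  refine ⟨?_, hR, _, hC, hdiff⟩
  rw [← mem_pIntegralSubring hp, sub_eq_iff_eq_add.mp hdiff]
  exact add_mem (mul_mem (pow_mem (hnat _) _) hC) hR
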